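/- Let $R$ be a commutative noetherian local ring with maximal ideal $\mathfrak m$. A differential $R$-module is an $R$-module $D$ together with an $R$-linear map $\delta\colon D\to D$ with $\delta^2=0$; its homology is $H(D)=\operatorname{Ker}\delta/\operatorname{Im}\delta$. It is called acyclic if $H(D)=0$, and contractible if it is isomorphic, as a differential module, to $(C\oplus C,\ (c',c'')\mapsto(c'',0))$ for some $R$-module $C$. A retract of a differential module $F$ is a direct summand of $F$ as a differential module. A flag in $F$ is a family $(F^n)_{n\in\mathbb Z}$ of $R$-submodules of $F$ with $F^n\subseteq F^{n+1}$, $F^{-1}=0$, $\bigcup_n F^n=F$ and $\delta(F^n)\subseteq F^{n-1}$ for all $n$; it is flat (respectively, projective) if every $R$-module $F^n/F^{n-1}$ is flat (respectively, projective). For an $R$-module $M$, the tensor product $M\otimes_R D$ is a differential module with differentiation $M\otimes_R\delta$. Theorem. Let $M$ be an $R$-module with $\mathfrak mM\neq M$, and let $D$ be a retract of a differential $R$-module $F$ that admits a flat flag. If $H(D)$ is finitely generated over $R$ and $M\otimes_R D$ is acyclic, then $D$ is acyclic. If, in addition, $F$ admits a projective flag, then $D$ is contractible. -/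

import Mathlib

open scoped TensorProduct

universe u v w

/-- A differential `R`-module: an `R`-module `D` with an `R`-linear endomorphism `δ` satisfying
`δ² = 0`. -/
structure DiffModule (R : Type u) [CommRing R] where
  /-- The underlying type. -/
  carrier : Type v
  [addCommGroup : AddCommGroup carrier]
  [module : Module R carrier]
  /-- The differentiation. -/
  δ : carrier →ₗ[R] carrier
  δ_comp_δ : δ ∘ₗ δ = 0

namespace DiffModule

variable {R : Type u} [CommRing R]

instance : CoeSort (DiffModule.{u, v} R) (Type v) := ⟨DiffModule.carrier⟩

instance (D : DiffModule.{u, v} R) : AddCommGroup D := D.addCommGroup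

instance (D : DiffModule.{u, v} R) : Module R D := D.module

/-- The homology `H(D) = Ker δ / Im δ`, an `R`-module. -/
abbrev Homology (D : DiffModule.{u, v} R) : Type v :=
  LinearMap.ker D.δ ⧸ (LinearMap.range D.δ).submoduleOf (LinearMap.ker D.δ)

/-- `D` is acyclic if `H(D) = 0`. -/
def IsAcyclic (D : DiffModule.{u, v} R) : Prop :=
  Subsingleton D.Homology

/-- A morphism of differential modules: an `R`-linear map commuting with the differentiations. -/
structure Hom (D : DiffModule.{u, v} R) (E : DiffModule.{u, w} R) where
  /-- The underlying linear map. -/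
  toLinearMap : D →ₗ[R] E
  comm : E.δ ∘ₗ toLinearMap = toLinearMap ∘ₗ D.δ

/-- An isomorphism of differential modules: a bijective morphism. -/
structure Iso (D : DiffModule.{u, v} R) (E : DiffModule.{u, w} R) where
  /-- The underlying linear equivalence. -/
  toLinearEquiv : D ≃ₗ[R] E
  comm : E.δ ∘ₗ toLinearEquiv.toLinearMap = toLinearEquiv.toLinearMap ∘ₗ D.δ

/-- `D` is a retract of `F`, i.e. a direct summand of `F` as a differential module: there are
morphisms `ι : D → F` and `π : F → D` of differential modules with `π ∘ ι = id`. The complement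
of `ι D` in `F` is the differential submodule `Ker π`. -/
def IsRetract (D : DiffModule.{u, v} R) (F : DiffModule.{u, w} R) : Prop :=
  ∃ (ι : Hom D F) (π : Hom F D), π.toLinearMap ∘ₗ ι.toLinearMap = LinearMap.id

/-- The differential module `M ⊗ D = (M ⊗ D, M ⊗ δ)` for an `R`-module `M`. -/
noncomputable def tensor (M : Type w) [AddCommGroup M] [Module R M] (D : DiffModule.{u, v} R) :
    DiffModule.{u, max w v} R where
  carrier := M ⊗[R] D
  δ := LinearMap.lTensor M D.δ
  δ_comp_δ := by rw [← LinearMap.lTensor_comp, D.δ_comp_δ, LinearMap.lTensor_zero]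

/-- The differential module `(C ⊕ C, (c', c'') ↦ (c'', 0))`. -/
def double (C : Type v) [AddCommGroup C] [Module R C] : DiffModule.{u, v} R where
  carrier := C × C
  δ := LinearMap.inl R C C ∘ₗ LinearMap.snd R C C
  δ_comp_δ := by ext <;> simp

/-- `D` is contractible if it is isomorphic to `(C ⊕ C, (c', c'') ↦ (c'', 0))` for some
`R`-module `C`. -/
def IsContractible (D : DiffModule.{u, v} R) : Prop :=
  ∃ (C : Type v) (_ : AddCommGroup C) (_ : Module R C),
    Nonempty (Iso D (double (R := R) C))

/-- A differential flag in `F`: an increasing family of submodules `Fⁿ`, `n ∈ ℤ`, with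
`F⁻¹ = 0`, `⋃ Fⁿ = F` and `δ(Fⁿ) ⊆ Fⁿ⁻¹`. -/
structure Flag (F : DiffModule.{u, v} R) where
  /-- The member `Fⁿ` of the flag. -/
  filt : ℤ → Submodule R F
  le_succ : ∀ n, filt n ≤ filt (n + 1)
  filt_neg_one : filt (-1) = ⊥
  iUnion_filt : ⋃ n, (filt n : Set F) = Set.univ
  map_δ_le : ∀ n, (filt n).map F.δ ≤ filt (n - 1)

namespace Flag

variable {F : DiffModule.{u, v} R}

/-- The `n`-th fold `Fₙ = Fⁿ / Fⁿ⁻¹`. -/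
abbrev Fold (𝓕 : Flag F) (n : ℤ) : Type v :=
  𝓕.filt n ⧸ (𝓕.filt (n - 1)).submoduleOf (𝓕.filt n)

/-- A flag is flat if every fold is a flat `R`-module. -/
def IsFlat (𝓕 : Flag F) : Prop :=
  ∀ n, Module.Flat R (𝓕.Fold n)

/-- A flag is projective if every fold is a projective `R`-module. -/
def IsProjective (𝓕 : Flag F) : Prop :=
  ∀ n, Module.Projective R (𝓕.Fold n)

end Flag

end DiffModule

/-! Write k = R/𝔪. Since 𝔪M ≠ M, some φ : M → k and a ∈ M satisfy φ(a) = 1. The morphism F → M ⊗ D,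
x ↦ a ⊗ π(x), runs from a differential module with a flat flag to an acyclic one, so it vanishes in
homology after tensoring with k (`exists_lTensor_eq_of_flat_flag`). Preceded by k ⊗ ι and followed
by the map k ⊗ M ⊗ D → k ⊗ D induced by φ, it becomes the identity, so k ⊗ D is acyclic.

To pass from k ⊗ D to D, take successive cones of multiplication by generators of 𝔪. Cones preserve
flatness, finiteness of homology and acyclicity modulo 𝔪; by Nakayama, acyclicity descends from the
cone (`LinearMap.exact_of_exact_coneSMul`). Once all generators act null-homotopically, noetherian
induction on I makes every (R/I) ⊗ D acyclic, and I = 0 is the claim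
(`exact_lTensor_quotient_of_homotopy`).

If F has a projective flag, π : F → D is null-homotopic because D is acyclic
(`exists_homotopy_of_projective_flag`). Composing with ι contracts D. -/

/-! ### Flatness along filtrations with flat quotients -/

section Flatness

variable {R : Type u} [CommRing R] {M : Type v} [AddCommGroup M] [Module R M]

theorem Submodule.lTensor_inclusion_injective {A B : Submodule R M} (h : A ≤ B)
    [Module.Flat R (B ⧸ A.submoduleOf B)] (K : Type*) [AddCommGroup K] [Module R K] :
    Function.Injective ((Submodule.inclusion h).lTensor K) := by
  refine LinearMap.lTensor_injective_of_exact_of_flat (A.submoduleOf B).mkQ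
    (Submodule.mkQ_surjective _) _ (Submodule.inclusion_injective h) ?_ K
  intro x
  rw [Submodule.mkQ_apply, Submodule.Quotient.mk_eq_zero, Submodule.submoduleOf,
    Submodule.mem_comap]
  exact ⟨fun hx => ⟨⟨x, hx⟩, rfl⟩, by rintro ⟨y, rfl⟩; exact y.2⟩

/-- Four-lemma chase: a kernel element dies in the M'' term, hence comes from M', where flatness of
M' kills it. Passing back to M' needs P ⊗ M' → P ⊗ M to be injective, which holds because M'' is
flat. -/
theorem Module.Flat.of_exact {M' M'' : Type*} [AddCommGroup M'] [Module R M']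
    [AddCommGroup M''] [Module R M''] [Module.Flat R M'] [Module.Flat R M'']
    (f : M' →ₗ[R] M) (g : M →ₗ[R] M'') (hf : Function.Injective f)
    (hg : Function.Surjective g) (h : Function.Exact f g) : Module.Flat R M := by
  refine (Module.flat_iff R M).2 fun P _ _ _ N _ => ?_
  let _ : AddCommGroup P := Module.addCommMonoidToAddCommGroup R
  rw [injective_iff_map_eq_zero]
  intro x hx
  have h1 : g.lTensor N x = 0 := by
    apply Module.Flat.rTensor_preserves_injective_linearMap (M := M'') N.subtype
      N.subtype_injective
    rw [map_zero, ← LinearMap.comp_apply, LinearMap.rTensor_comp_lTensor,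
      ← LinearMap.lTensor_comp_rTensor, LinearMap.comp_apply, hx, map_zero]
  obtain ⟨y, rfl⟩ := (_root_.lTensor_exact N h hg x).1 h1
  suffices y = 0 by rw [this, map_zero]
  apply Module.Flat.rTensor_preserves_injective_linearMap (M := M') N.subtype
    N.subtype_injective
  apply LinearMap.lTensor_injective_of_exact_of_flat g hg f hf h P
  rw [map_zero, map_zero, ← LinearMap.comp_apply, LinearMap.lTensor_comp_rTensor,
    ← LinearMap.rTensor_comp_lTensor, LinearMap.comp_apply, hx]

variable {G : ℕ → Submodule R M}

theorem Monotone.exists_fg_le (hG : Monotone G) (hU : ∀ x, ∃ n, x ∈ G n) {P : Submodule R M}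
    (hP : P.FG) : ∃ n, P ≤ G n := by
  obtain ⟨s, rfl⟩ := hP
  choose n hn using hU
  refine ⟨s.sup n, Submodule.span_le.2 fun x hx => hG (Finset.le_sup hx) (hn x)⟩

theorem Submodule.exists_lTensor_subtype_eq (hG : Monotone G) (hU : ∀ x, ∃ n, x ∈ G n)
    {K : Type*} [AddCommGroup K] [Module R K] (z : K ⊗[R] M) :
    ∃ n, ∃ y : K ⊗[R] G n, (G n).subtype.lTensor K y = z := by
  induction z with
  | zero => exact ⟨0, 0, map_zero _⟩
  | tmul k x =>
    obtain ⟨n, hn⟩ := hU x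
    exact ⟨n, k ⊗ₜ ⟨x, hn⟩, rfl⟩
  | add a b ha hb =>
    obtain ⟨n, a, rfl⟩ := ha
    obtain ⟨m, b, rfl⟩ := hb
    have hn := hG (le_max_left n m)
    have hm := hG (le_max_right n m)
    refine ⟨max n m, (Submodule.inclusion hn).lTensor K a +
      (Submodule.inclusion hm).lTensor K b, ?_⟩
    rw [map_add, ← LinearMap.lTensor_comp_apply, ← LinearMap.lTensor_comp_apply,
      Submodule.subtype_comp_inclusion, Submodule.subtype_comp_inclusion]

theorem Submodule.lTensor_inclusion_injective_of_flat_succ (hG : Monotone G)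
    (hflat : ∀ n, Module.Flat R (G (n + 1) ⧸ (G n).submoduleOf (G (n + 1))))
    (K : Type*) [AddCommGroup K] [Module R K] {n m : ℕ} (h : n ≤ m) :
    Function.Injective ((Submodule.inclusion (hG h)).lTensor K) := by
  induction m, h using Nat.le_induction with
  | base =>
    rw [show Submodule.inclusion (hG le_rfl) = LinearMap.id (M := G n) from rfl,
      LinearMap.lTensor_id]
    exact Function.injective_id
  | succ m h ih =>
    rw [show Submodule.inclusion (hG (h.trans m.le_succ)) =
      Submodule.inclusion (hG m.le_succ) ∘ₗ Submodule.inclusion (hG h) from rfl,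
      LinearMap.lTensor_comp]
    exact (Submodule.lTensor_inclusion_injective (hG m.le_succ) K).comp ih

/-- A relation in K ⊗ M already holds over a finitely generated submodule, hence over some G m, and
the finite stages embed into one another after tensoring. -/
theorem Submodule.lTensor_subtype_injective_of_flat_succ (hG : Monotone G)
    (hU : ∀ x, ∃ n, x ∈ G n)
    (hflat : ∀ n, Module.Flat R (G (n + 1) ⧸ (G n).submoduleOf (G (n + 1))))
    (K : Type*) [AddCommGroup K] [Module R K] (n : ℕ) :
    Function.Injective ((G n).subtype.lTensor K) := by
  rw [LinearMap.lTensor_inj_iff_rTensor_inj, injective_iff_map_eq_zero]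
  intro z hz
  obtain ⟨J, hJ, hle, y, rfl⟩ := Submodule.exists_fg_le_eq_rTensor_inclusion z
  rw [← LinearMap.rTensor_comp_apply, Submodule.subtype_comp_inclusion,
    ← map_zero (J.subtype.rTensor K)] at hz
  obtain ⟨N, hN, hJN, hy⟩ := hJ.exists_rTensor_fg_inclusion_eq hz
  obtain ⟨m, hm⟩ := hG.exists_fg_le hU hN
  have hinj := (LinearMap.lTensor_inj_iff_rTensor_inj K _).1
    (Submodule.lTensor_inclusion_injective_of_flat_succ hG hflat K (le_max_left n m))
  apply hinj
  rw [map_zero, ← LinearMap.rTensor_comp_apply]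
  have hNm : N ≤ G (max n m) := hm.trans (hG (le_max_right n m))
  rw [show Submodule.inclusion (hG (le_max_left n m)) ∘ₗ Submodule.inclusion hle =
    Submodule.inclusion hNm ∘ₗ Submodule.inclusion hJN from rfl, LinearMap.rTensor_comp_apply, hy,
    map_zero, map_zero]

theorem Submodule.flat_of_flat_succ (hG : Monotone G) (h0 : G 0 = ⊥)
    (hflat : ∀ n, Module.Flat R (G (n + 1) ⧸ (G n).submoduleOf (G (n + 1)))) (n : ℕ) :
    Module.Flat R (G n) := by
  induction n with
  | zero =>
    rw [h0]
    infer_instance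
  | succ n ih =>
    refine Module.Flat.of_exact (Submodule.inclusion (hG n.le_succ))
      ((G n).submoduleOf (G (n + 1))).mkQ (Submodule.inclusion_injective _)
      (Submodule.mkQ_surjective _) ?_
    intro x
    rw [Submodule.mkQ_apply, Submodule.Quotient.mk_eq_zero, Submodule.submoduleOf,
      Submodule.mem_comap]
    exact ⟨fun hx => ⟨⟨x, hx⟩, rfl⟩, by rintro ⟨y, rfl⟩; exact y.2⟩

theorem Module.Flat.of_flat_succ (hG : Monotone G) (h0 : G 0 = ⊥)
    (hU : ∀ x, ∃ n, x ∈ G n)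
    (hflat : ∀ n, Module.Flat R (G (n + 1) ⧸ (G n).submoduleOf (G (n + 1)))) :
    Module.Flat R M := by
  refine (Module.flat_iff R M).2 fun P _ _ _ N _ => ?_
  let _ : AddCommGroup P := Module.addCommMonoidToAddCommGroup R
  rw [injective_iff_map_eq_zero]
  intro z hz
  obtain ⟨n, y, rfl⟩ := Submodule.exists_lTensor_subtype_eq hG hU z
  have := Submodule.flat_of_flat_succ hG h0 hflat n
  suffices y = 0 by rw [this, map_zero]
  apply Module.Flat.rTensor_preserves_injective_linearMap (M := G n) N.subtype
    N.subtype_injective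
  apply Submodule.lTensor_subtype_injective_of_flat_succ hG hU hflat P n
  rw [map_zero, map_zero, ← LinearMap.comp_apply, LinearMap.lTensor_comp_rTensor,
    ← LinearMap.rTensor_comp_lTensor, LinearMap.comp_apply, hz]

end Flatness

theorem LinearMap.rTensor_lTensor_apply {R : Type*} [CommSemiring R] {A A' B B' : Type*}
    [AddCommMonoid A] [AddCommMonoid A'] [AddCommMonoid B] [AddCommMonoid B'] [Module R A]
    [Module R A'] [Module R B] [Module R B'] (g : A →ₗ[R] A') (f : B →ₗ[R] B') (z : A ⊗[R] B) :
    g.rTensor B' (f.lTensor A z) = f.lTensor A' (g.rTensor B z) := by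
  rw [← LinearMap.comp_apply, LinearMap.rTensor_comp_lTensor, ← LinearMap.lTensor_comp_rTensor,
    LinearMap.comp_apply]

/-! ### Morphisms from flat flags to acyclic modules -/

section FlatFlag

variable {R : Type u} [CommRing R] {F : Type v} [AddCommGroup F] [Module R F]
  {E : Type w} [AddCommGroup E] [Module R E] {G : ℕ → Submodule R F}

/-- A morphism from a differential module with a flat flag to an acyclic one remains zero in
homology after tensoring with any module. -/
theorem exists_lTensor_eq_of_flat_flag {δ : F →ₗ[R] F} {ε : E →ₗ[R] E} {f : F →ₗ[R] E}
    (hf : ε ∘ₗ f = f ∘ₗ δ) (hδ : δ ∘ₗ δ = 0) (hε : Function.Exact ε ε) (hG : Monotone G)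
    (h0 : G 0 = ⊥) (hU : ∀ x, ∃ n, x ∈ G n)
    (hflat : ∀ n, Module.Flat R (G (n + 1) ⧸ (G n).submoduleOf (G (n + 1))))
    (hGδ : ∀ n, ∀ x ∈ G (n + 1), δ x ∈ G n) {K : Type u} [AddCommGroup K] [Module R K]
    (z : K ⊗[R] F) (hz : δ.lTensor K z = 0) : ∃ y, ε.lTensor K y = f.lTensor K z := by
  have : Module.Flat R F := Module.Flat.of_flat_succ hG h0 hU hflat
  obtain ⟨n, z, rfl⟩ := Submodule.exists_lTensor_subtype_eq hG hU z
  induction n generalizing K with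
  | zero =>
    refine ⟨0, ?_⟩
    have : (G 0).subtype = 0 := by
      ext ⟨x, hx⟩
      rw [h0] at hx
      exact hx
    rw [this, LinearMap.lTensor_zero, LinearMap.zero_apply, map_zero, map_zero]
  | succ n ih =>
    -- Dimension shifting: one step down the flag is paid for by replacing K with the kernel Z of a
    -- free cover, so the induction must range over all K.
    obtain ⟨P, _, _, _, p, hp⟩ : ∃ (P : Type u) (_ : AddCommGroup P) (_ : Module R P)
        (_ : Module.Flat R P) (p : P →ₗ[R] K), Function.Surjective p :=
      ⟨K →₀ R, inferInstance, inferInstance, inferInstance, Finsupp.linearCombination R id,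
        Finsupp.linearCombination_surjective _ Function.surjective_id⟩
    let Z := LinearMap.ker p
    let i : Z →ₗ[R] P := Z.subtype
    have hi : Function.Injective i := Z.subtype_injective
    have hip : Function.Exact i p := LinearMap.exact_subtype_ker_map p
    let d : G (n + 1) →ₗ[R] G n := δ.restrict (hGδ n)
    have hd : (G n).subtype ∘ₗ d = δ ∘ₗ (G (n + 1)).subtype := rfl
    obtain ⟨z, rfl⟩ := LinearMap.rTensor_surjective (G (n + 1)) hp z
    have hw : p.rTensor (G n) (d.lTensor P z) = 0 := by
      apply Submodule.lTensor_subtype_injective_of_flat_succ hG hU hflat K n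
      rw [map_zero, ← hz]
      rw [LinearMap.rTensor_lTensor_apply, ← LinearMap.lTensor_comp_apply, hd,
        LinearMap.lTensor_comp_apply]
    obtain ⟨z₁, hz₁⟩ := (rTensor_exact (G n) hip hp _).1 hw
    have hz₁' : δ.lTensor Z ((G n).subtype.lTensor Z z₁) = 0 := by
      apply Module.Flat.rTensor_preserves_injective_linearMap (M := F) i hi
      rw [map_zero, LinearMap.rTensor_lTensor_apply, LinearMap.rTensor_lTensor_apply, hz₁,
        ← LinearMap.lTensor_comp_apply, ← LinearMap.lTensor_comp_apply, LinearMap.comp_assoc, hd,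
        ← LinearMap.comp_assoc, hδ, LinearMap.zero_comp,
        LinearMap.lTensor_zero, LinearMap.zero_apply]
    obtain ⟨y₁, hy₁⟩ := ih z₁ hz₁'
    -- Over P the image of the lifted z need not be a cycle; subtracting y₁ makes it one. It then
    -- bounds since P is flat, and the correction dies in K.
    have hx : ε.lTensor P (f.lTensor _ ((G (n + 1)).subtype.lTensor _ z) -
        i.rTensor E y₁) = 0 := by
      rw [map_sub, ← LinearMap.rTensor_lTensor_apply, hy₁, LinearMap.rTensor_lTensor_apply,
        LinearMap.rTensor_lTensor_apply, hz₁, ← LinearMap.lTensor_comp_apply _ _ d, hd,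
        LinearMap.lTensor_comp_apply, ← LinearMap.lTensor_comp_apply, hf,
        LinearMap.lTensor_comp_apply, sub_self]
    obtain ⟨y, hy⟩ := (Module.Flat.lTensor_exact P hε _).1 hx
    refine ⟨p.rTensor E y, ?_⟩
    rw [← LinearMap.rTensor_lTensor_apply, hy, map_sub, ← LinearMap.rTensor_comp_apply,
      hip.linearMap_comp_eq_zero, LinearMap.rTensor_zero, LinearMap.zero_apply, sub_zero,
      LinearMap.rTensor_lTensor_apply, LinearMap.rTensor_lTensor_apply]

end FlatFlag

/-! ### Acyclicity of reductions modulo ideals -/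

section Acyclicity

variable {R : Type u} [CommRing R]

theorem LinearMap.exact_self_of_comp_self_eq_zero {D : Type*} [AddCommGroup D] [Module R D]
    {δ : D →ₗ[R] D} (hδ : δ ∘ₗ δ = 0) (h : ∀ z, δ z = 0 → ∃ y, δ y = z) :
    Function.Exact δ δ := fun z =>
  ⟨h z, by rintro ⟨y, rfl⟩; exact LinearMap.congr_fun hδ y⟩

theorem LinearMap.lTensor_comp_self_eq_zero {D : Type*} [AddCommGroup D] [Module R D]
    {δ : D →ₗ[R] D} (hδ : δ ∘ₗ δ = 0) (K : Type*) [AddCommGroup K] [Module R K] :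
    δ.lTensor K ∘ₗ δ.lTensor K = 0 := by
  rw [← LinearMap.lTensor_comp, hδ, LinearMap.lTensor_zero]

/-- In a short exact sequence of differential modules with acyclic cokernel, the homology of the
kernel surjects onto that of the middle term. -/
theorem LinearMap.exists_eq_add_of_exact {A B C : Type*} [AddCommGroup A] [AddCommGroup B]
    [AddCommGroup C] [Module R A] [Module R B] [Module R C] {α : A →ₗ[R] A} {β : B →ₗ[R] B}
    {γ : C →ₗ[R] C} (hβ : β ∘ₗ β = 0) {i : A →ₗ[R] B} {p : B →ₗ[R] C}
    (hi : Function.Injective i) (hp : Function.Surjective p) (hip : Function.Exact i p)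
    (hαβ : β ∘ₗ i = i ∘ₗ α) (hβγ : γ ∘ₗ p = p ∘ₗ β) (hγ : Function.Exact γ γ)
    {z : B} (hz : β z = 0) : ∃ b w, α w = 0 ∧ z = β b + i w := by
  have h1 : γ (p z) = 0 := by
    rw [← LinearMap.comp_apply, hβγ, LinearMap.comp_apply, hz, map_zero]
  obtain ⟨c, hc⟩ := (hγ _).1 h1
  obtain ⟨b, rfl⟩ := hp c
  have h2 : p (z - β b) = 0 := by
    rw [map_sub, ← hc, ← LinearMap.comp_apply, hβγ, LinearMap.comp_apply, sub_self]
  obtain ⟨w, hw⟩ := (hip _).1 h2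
  refine ⟨b, w, hi ?_, by rw [hw]; abel⟩
  rw [map_zero, ← LinearMap.comp_apply, ← hαβ, LinearMap.comp_apply, hw, map_sub, hz,
    ← LinearMap.comp_apply, hβ, LinearMap.zero_apply, sub_zero]

theorem LinearMap.exact_self_of_exact {A B C : Type*} [AddCommGroup A] [AddCommGroup B]
    [AddCommGroup C] [Module R A] [Module R B] [Module R C] {α : A →ₗ[R] A} {β : B →ₗ[R] B}
    {γ : C →ₗ[R] C} (hβ : β ∘ₗ β = 0) {i : A →ₗ[R] B} {p : B →ₗ[R] C}
    (hi : Function.Injective i) (hp : Function.Surjective p) (hip : Function.Exact i p)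
    (hαβ : β ∘ₗ i = i ∘ₗ α) (hβγ : γ ∘ₗ p = p ∘ₗ β) (hα : Function.Exact α α)
    (hγ : Function.Exact γ γ) : Function.Exact β β := by
  refine LinearMap.exact_self_of_comp_self_eq_zero hβ fun z hz => ?_
  obtain ⟨b, w, hw, rfl⟩ := LinearMap.exists_eq_add_of_exact hβ hi hp hip hαβ hβγ hγ hz
  obtain ⟨a, rfl⟩ := (hα w).1 hw
  refine ⟨b + i a, ?_⟩
  rw [map_add, ← LinearMap.comp_apply β i, hαβ, LinearMap.comp_apply]

theorem Ideal.exists_linearMap_quotient_eq_one {M : Type*} [AddCommGroup M] [Module R M]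
    (m : Ideal R) [m.IsMaximal] (hM : m • (⊤ : Submodule R M) ≠ ⊤) :
    ∃ (φ : M →ₗ[R] R ⧸ m) (a : M), φ a = 1 := by
  let _ : Field (R ⧸ m) := Ideal.Quotient.field m
  have : Nontrivial (M ⧸ m • (⊤ : Submodule R M)) := Submodule.Quotient.nontrivial_iff.2 hM
  obtain ⟨a, ha⟩ := exists_ne (0 : M ⧸ m • (⊤ : Submodule R M))
  obtain ⟨a, rfl⟩ := Submodule.mkQ_surjective _ a
  obtain ⟨φ, hφ⟩ : ∃ φ : Module.Dual (R ⧸ m) (M ⧸ m • (⊤ : Submodule R M)),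
      φ (Submodule.mkQ _ a) ≠ 0 := by
    by_contra! h
    exact ha ((Module.forall_dual_apply_eq_zero_iff (R ⧸ m) _).1 h)
  -- Rescale a by a lift of the inverse of its nonzero value, to reach the value 1.
  obtain ⟨r, hr⟩ := Ideal.Quotient.mk_surjective (φ (Submodule.mkQ _ a))⁻¹
  refine ⟨φ.restrictScalars R ∘ₗ Submodule.mkQ _, r • a, ?_⟩
  rw [map_smul, LinearMap.comp_apply, LinearMap.restrictScalars_apply, Algebra.smul_def,
    Ideal.Quotient.algebraMap_eq, hr, inv_mul_cancel₀ hφ]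

theorem exact_lTensor_quotient_of_exact_lTensor {M : Type*} [AddCommGroup M] [Module R M]
    {m : Ideal R} [m.IsMaximal] (hM : m • (⊤ : Submodule R M) ≠ ⊤)
    {F D : Type*} [AddCommGroup F] [Module R F] [AddCommGroup D] [Module R D]
    {δ : F →ₗ[R] F} {ε : D →ₗ[R] D} {ι : D →ₗ[R] F} {π : F →ₗ[R] D} (hπι : π ∘ₗ ι = LinearMap.id)
    (hι : δ ∘ₗ ι = ι ∘ₗ ε) (hπ : ε ∘ₗ π = π ∘ₗ δ)
    (hδ : δ ∘ₗ δ = 0) (hε : ε ∘ₗ ε = 0) {G : ℕ → Submodule R F} (hG : Monotone G)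
    (h0 : G 0 = ⊥) (hU : ∀ x, ∃ n, x ∈ G n)
    (hflat : ∀ n, Module.Flat R (G (n + 1) ⧸ (G n).submoduleOf (G (n + 1))))
    (hGδ : ∀ n, ∀ x ∈ G (n + 1), δ x ∈ G n)
    (hexact : Function.Exact (ε.lTensor M) (ε.lTensor M)) :
    Function.Exact (ε.lTensor (R ⧸ m)) (ε.lTensor (R ⧸ m)) := by
  refine LinearMap.exact_self_of_comp_self_eq_zero (LinearMap.lTensor_comp_self_eq_zero hε _)
    fun z hz => ?_
  obtain ⟨φ, a, ha⟩ := Ideal.exists_linearMap_quotient_eq_one m hM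
  have hf : ε.lTensor M ∘ₗ (TensorProduct.mk R M D a ∘ₗ π) =
      (TensorProduct.mk R M D a ∘ₗ π) ∘ₗ δ := by
    rw [LinearMap.comp_assoc, ← hπ]
    rfl
  obtain ⟨y, hy⟩ := exists_lTensor_eq_of_flat_flag hf hδ hexact hG h0 hU hflat hGδ
    (ι.lTensor (R ⧸ m) z) (by
      rw [← LinearMap.lTensor_comp_apply, hι, LinearMap.lTensor_comp_apply, hz, map_zero])
  -- Contraction b ⊗ m ⊗ d ↦ b φ(m) ⊗ d, a left inverse of d ↦ a ⊗ d tensored with R/𝔪.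
  let c : (R ⧸ m) ⊗[R] (M ⊗[R] D) →ₗ[R] (R ⧸ m) ⊗[R] D :=
    (TensorProduct.lift ((LinearMap.mul R (R ⧸ m)).compl₂ φ)).rTensor D ∘ₗ
      (TensorProduct.assoc R (R ⧸ m) M D).symm.toLinearMap
  have hc : c ∘ₗ (TensorProduct.mk R M D a).lTensor (R ⧸ m) = LinearMap.id := by
    ext
    simp [c, ha]
  have hcε : c ∘ₗ (ε.lTensor M).lTensor (R ⧸ m) = ε.lTensor (R ⧸ m) ∘ₗ c := by
    ext
    simp [c]
  refine ⟨c y, ?_⟩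
  rw [← LinearMap.comp_apply, ← hcε, LinearMap.comp_apply, hy, ← LinearMap.lTensor_comp_apply,
    LinearMap.comp_assoc, hπι, LinearMap.comp_id, ← LinearMap.comp_apply, hc, LinearMap.id_apply]

/-- With J = (I : x), multiplication by x identifies R/J with the kernel of R/I → R/(I + xR). This
sequence drives the noetherian induction. -/
theorem Ideal.exists_linearMap_quotient_mul (I : Ideal R) (x : R) :
    ∃ (J : Ideal R) (_ : I ≤ J) (f : (R ⧸ J) →ₗ[R] R ⧸ I)
      (g : (R ⧸ I) →ₗ[R] R ⧸ (I ⊔ Ideal.span {x})),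
      (∀ r, f (Ideal.Quotient.mk J r) = Ideal.Quotient.mk I (x * r)) ∧ Function.Injective f ∧
        Function.Surjective g ∧ Function.Exact f g := by
  let J : Ideal R := Submodule.comap (LinearMap.mulLeft R x) I
  refine ⟨J, fun r hr => I.mul_mem_left x hr, J.mapQ I (LinearMap.mulLeft R x) le_rfl,
    Submodule.factor le_sup_left, fun r => rfl, ?_, Submodule.factor_surjective _, ?_⟩
  · rw [injective_iff_map_eq_zero]
    intro y hy
    obtain ⟨r, rfl⟩ := Ideal.Quotient.mk_surjective y
    exact Ideal.Quotient.eq_zero_iff_mem.2 (Ideal.Quotient.eq_zero_iff_mem.1 hy :)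
  · intro y
    obtain ⟨r, rfl⟩ := Ideal.Quotient.mk_surjective y
    refine ⟨fun h => ?_, ?_⟩
    · have h : r ∈ I ⊔ Ideal.span {x} := Ideal.Quotient.eq_zero_iff_mem.1 h
      obtain ⟨s, hs, t, ht, rfl⟩ := Submodule.mem_sup.1 h
      obtain ⟨b, rfl⟩ := Ideal.mem_span_singleton'.1 ht
      refine ⟨Ideal.Quotient.mk J b, Ideal.Quotient.eq.2 ?_⟩
      rw [LinearMap.mulLeft_apply, mul_comm, sub_add_cancel_right]
      exact I.neg_mem hs
    · rintro ⟨b, hb⟩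
      obtain ⟨b, rfl⟩ := Ideal.Quotient.mk_surjective b
      rw [← hb]
      exact Ideal.Quotient.eq_zero_iff_mem.2 (Ideal.mem_sup_right
        (Ideal.mul_mem_right _ _ (Ideal.mem_span_singleton_self x)))

/-- If generators of the maximal ideal of a noetherian local ring act null-homotopically on a flat
differential module whose reduction modulo the maximal ideal is acyclic, then all its reductions
modulo ideals are acyclic. -/
theorem exact_lTensor_quotient_of_homotopy [IsLocalRing R] [IsNoetherianRing R] {D : Type*}
    [AddCommGroup D] [Module R D] [Module.Flat R D] {δ : D →ₗ[R] D} (hδ : δ ∘ₗ δ = 0)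
    {S : Set R} (hS : Ideal.span S = IsLocalRing.maximalIdeal R)
    (hhom : ∀ x ∈ S, ∃ h : D →ₗ[R] D, δ ∘ₗ h + h ∘ₗ δ = x • LinearMap.id)
    (hk : Function.Exact (δ.lTensor (R ⧸ IsLocalRing.maximalIdeal R))
      (δ.lTensor (R ⧸ IsLocalRing.maximalIdeal R))) (I : Ideal R) :
    Function.Exact (δ.lTensor (R ⧸ I)) (δ.lTensor (R ⧸ I)) := by
  induction I using IsNoetherian.induction with | hgt I ih =>
  by_cases hI : I = ⊤
  · have : Subsingleton (R ⧸ I) := Ideal.Quotient.subsingleton_iff.2 hI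
    have : Subsingleton ((R ⧸ I) ⊗[R] D) := inferInstance
    exact fun z => ⟨fun _ => ⟨0, Subsingleton.elim _ _⟩, fun _ => Subsingleton.elim _ _⟩
  by_cases hSI : S ⊆ I
  · have : IsLocalRing.maximalIdeal R = I :=
      (IsLocalRing.maximalIdeal.isMaximal R).eq_of_le hI (hS ▸ Ideal.span_le.2 hSI)
    subst this
    exact hk
  obtain ⟨x, hxS, hxI⟩ := Set.not_subset.1 hSI
  obtain ⟨J, hIJ, f, g, hfmk, hf, hg, hfg⟩ := Ideal.exists_linearMap_quotient_mul I x
  have hlt : I < I ⊔ Ideal.span {x} := lt_of_le_of_ne le_sup_left fun h =>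
    hxI (h ▸ Ideal.mem_sup_right (Ideal.mem_span_singleton_self x))
  have comm {A B : Type u} [AddCommGroup A] [AddCommGroup B] [Module R A] [Module R B]
      (e : A →ₗ[R] B) : δ.lTensor B ∘ₗ e.rTensor D = e.rTensor D ∘ₗ δ.lTensor A := by
    rw [LinearMap.lTensor_comp_rTensor, LinearMap.rTensor_comp_lTensor]
  refine LinearMap.exact_self_of_comp_self_eq_zero (LinearMap.lTensor_comp_self_eq_zero hδ _)
    fun z hz => ?_
  obtain ⟨b, w, hw, rfl⟩ := LinearMap.exists_eq_add_of_exact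
    (LinearMap.lTensor_comp_self_eq_zero hδ _)
    (Module.Flat.rTensor_preserves_injective_linearMap (M := D) f hf)
    (LinearMap.rTensor_surjective D hg) (rTensor_exact D hfg hg) (comm f) (comm g)
    (ih _ hlt) hz
  -- If J = I, then f is multiplication by x, and the homotopy makes xw a boundary. If J is strictly
  -- larger, the induction hypothesis makes w itself a boundary.
  rcases hIJ.eq_or_lt with rfl | hIJ
  · obtain ⟨h, hh⟩ := hhom x hxS
    refine ⟨b + h.lTensor _ w, ?_⟩
    have hfx : f = x • LinearMap.id := by
      ext
      exact hfmk 1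
    have := congrArg (fun e => e.lTensor (R ⧸ I) w) hh
    simp only [LinearMap.lTensor_add, LinearMap.lTensor_comp, LinearMap.add_apply,
      LinearMap.comp_apply, hw, map_zero, add_zero, LinearMap.lTensor_smul, LinearMap.lTensor_id,
      LinearMap.smul_apply, LinearMap.id_apply] at this
    rw [map_add, this, hfx, LinearMap.rTensor_smul, LinearMap.rTensor_id, LinearMap.smul_apply,
      LinearMap.id_apply]
  · obtain ⟨a, rfl⟩ := (ih J hIJ w).1 hw
    refine ⟨b + f.rTensor D a, ?_⟩
    rw [map_add, ← LinearMap.comp_apply (LinearMap.lTensor _ δ) (f.rTensor D), comm f,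
      LinearMap.comp_apply]

theorem exact_of_exact_lTensor_quotient_bot {D : Type*} [AddCommGroup D] [Module R D]
    {δ : D →ₗ[R] D} (hδ : δ ∘ₗ δ = 0)
    (h : Function.Exact (δ.lTensor (R ⧸ (⊥ : Ideal R))) (δ.lTensor (R ⧸ (⊥ : Ideal R)))) :
    Function.Exact δ δ := by
  refine LinearMap.exact_self_of_comp_self_eq_zero hδ fun z hz => ?_
  let e : (R ⧸ (⊥ : Ideal R)) ⊗[R] D →ₗ[R] D := (TensorProduct.lid R D).toLinearMap ∘ₗ
    (Submodule.quotEquivOfEqBot (⊥ : Ideal R) rfl).toLinearMap.rTensor D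
  have he : δ ∘ₗ e = e ∘ₗ δ.lTensor _ := by
    ext
    simp [e]
  obtain ⟨y, hy⟩ := (h (Ideal.Quotient.mk ⊥ 1 ⊗ₜ z)).1
    (by rw [LinearMap.lTensor_tmul, hz, TensorProduct.tmul_zero])
  refine ⟨e y, ?_⟩
  rw [← LinearMap.comp_apply, he, LinearMap.comp_apply, hy]
  exact one_smul R z

end Acyclicity

/-! ### Cones of multiplication and descent by Nakayama -/

section Cone

variable {R : Type u} [CommRing R] {D : Type v} [AddCommGroup D] [Module R D]

/-- The differentiation of the mapping cone of multiplication by `x` on `(D, δ)`. -/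
def LinearMap.coneSMul (x : R) (δ : D →ₗ[R] D) : D × D →ₗ[R] D × D :=
  (δ ∘ₗ LinearMap.fst R D D + x • LinearMap.snd R D D).prod (-(δ ∘ₗ LinearMap.snd R D D))

@[simp]
theorem LinearMap.coneSMul_apply (x : R) (δ : D →ₗ[R] D) (a : D × D) :
    δ.coneSMul x a = (δ a.1 + x • a.2, -δ a.2) := rfl

variable {δ : D →ₗ[R] D} {x : R}

theorem LinearMap.coneSMul_comp_self (hδ : δ ∘ₗ δ = 0) :
    δ.coneSMul x ∘ₗ δ.coneSMul x = 0 := by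
  have hδ' (a) : δ (δ a) = 0 := LinearMap.congr_fun hδ a
  refine LinearMap.ext fun a => ?_
  simp [hδ']

theorem LinearMap.coneSMul_comp_inl :
    δ.coneSMul x ∘ₗ LinearMap.inl R D D = LinearMap.inl R D D ∘ₗ δ := by
  refine LinearMap.ext fun a => ?_
  simp

theorem LinearMap.snd_comp_coneSMul :
    (-δ) ∘ₗ LinearMap.snd R D D = LinearMap.snd R D D ∘ₗ δ.coneSMul x := by
  refine LinearMap.ext fun a => ?_
  simp

theorem Module.Flat.prod_self [Module.Flat R D] : Module.Flat R (D × D) :=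
  Module.Flat.of_exact (LinearMap.inl R D D) (LinearMap.snd R D D) LinearMap.inl_injective
    LinearMap.snd_surjective Function.Exact.inl_snd

/-- The cone is a split extension, as modules, of (D, -δ) by (D, δ), and the sign changes neither
kernel nor image. -/
theorem LinearMap.exact_lTensor_coneSMul (hδ : δ ∘ₗ δ = 0) (K : Type*) [AddCommGroup K]
    [Module R K] (h : Function.Exact (δ.lTensor K) (δ.lTensor K)) :
    Function.Exact ((δ.coneSMul x).lTensor K) ((δ.coneSMul x).lTensor K) := by
  refine LinearMap.exact_self_of_exact (γ := (-δ).lTensor K)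
    (i := (LinearMap.inl R D D).lTensor K) (p := (LinearMap.snd R D D).lTensor K)
    (LinearMap.lTensor_comp_self_eq_zero (LinearMap.coneSMul_comp_self hδ) K) ?_
    (LinearMap.lTensor_surjective K LinearMap.snd_surjective)
    (lTensor_exact K Function.Exact.inl_snd LinearMap.snd_surjective) ?_ ?_ h ?_
  · refine Function.LeftInverse.injective (g := (LinearMap.fst R D D).lTensor K) fun z => ?_
    rw [← LinearMap.lTensor_comp_apply, LinearMap.fst_comp_inl, LinearMap.lTensor_id,
      LinearMap.id_apply]
  · rw [← LinearMap.lTensor_comp, ← LinearMap.lTensor_comp, LinearMap.coneSMul_comp_inl]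
  · rw [← LinearMap.lTensor_comp, ← LinearMap.lTensor_comp, LinearMap.snd_comp_coneSMul]
  · intro z
    rw [LinearMap.lTensor_neg, LinearMap.neg_apply, neg_eq_zero, h z]
    exact ⟨fun ⟨y, hy⟩ => ⟨-y, by simpa using hy⟩, fun ⟨y, hy⟩ => ⟨-y, by simpa using hy⟩⟩

theorem LinearMap.coneSMul_homotopy_self :
    δ.coneSMul x ∘ₗ LinearMap.inr R D D ∘ₗ LinearMap.fst R D D +
      (LinearMap.inr R D D ∘ₗ LinearMap.fst R D D) ∘ₗ δ.coneSMul x = x • LinearMap.id := by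
  refine LinearMap.ext fun a => ?_
  simp [Prod.ext_iff]

theorem LinearMap.exists_coneSMul_homotopy {y : R}
    (h : ∃ s : D →ₗ[R] D, δ ∘ₗ s + s ∘ₗ δ = y • LinearMap.id) :
    ∃ s : D × D →ₗ[R] D × D, δ.coneSMul x ∘ₗ s + s ∘ₗ δ.coneSMul x = y • LinearMap.id := by
  obtain ⟨s, hs⟩ := h
  have hs' (a) : δ (s a) + s (δ a) = y • a := LinearMap.congr_fun hs a
  -- The sign on the second factor cancels the cross terms in x.
  refine ⟨s.prodMap (-s), LinearMap.ext fun a => Prod.ext ?_ ?_⟩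
  · simp [← hs']
    abel
  · simp [← hs']

/-- The homology of a square-zero endomorphism. -/
abbrev LinearMap.SelfHomology (δ : D →ₗ[R] D) : Type v :=
  LinearMap.ker δ ⧸ (LinearMap.range δ).submoduleOf (LinearMap.ker δ)

theorem LinearMap.subsingleton_selfHomology_iff (hδ : δ ∘ₗ δ = 0) :
    Subsingleton δ.SelfHomology ↔ Function.Exact δ δ := by
  rw [Submodule.Quotient.subsingleton_iff, Submodule.submoduleOf,
    Submodule.comap_subtype_eq_top]
  exact ⟨fun h => LinearMap.exact_self_of_comp_self_eq_zero hδ fun z hz => h hz,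
    fun h z hz => (h z).1 hz⟩

/-- Over a noetherian ring, exactness of H(D) → H(cone) → H(D) in the middle suffices. -/
theorem LinearMap.finite_selfHomology_coneSMul [IsNoetherianRing R]
    [Module.Finite R δ.SelfHomology] : Module.Finite R (δ.coneSMul x).SelfHomology := by
  let f : δ.SelfHomology →ₗ[R] (δ.coneSMul x).SelfHomology :=
    Submodule.mapQ _ _ ((LinearMap.inl R D D).restrict (p := LinearMap.ker δ)
      (q := LinearMap.ker (δ.coneSMul x)) fun a (ha : δ a = 0) => by simp [ha]) (by
        rintro ⟨_, _⟩ ⟨b, rfl⟩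
        exact ⟨(b, 0), show δ.coneSMul x (b, 0) = (δ b, (0 : D)) by simp⟩)
  let g : (δ.coneSMul x).SelfHomology →ₗ[R] δ.SelfHomology :=
    Submodule.mapQ _ _ ((LinearMap.snd R D D).restrict (p := LinearMap.ker (δ.coneSMul x))
      (q := LinearMap.ker δ) fun a ha => by simpa using congrArg Prod.snd ha) (by
        rintro ⟨_, _⟩ ⟨b, rfl⟩
        exact ⟨-b.2, by simp⟩)
  have : IsNoetherian R δ.SelfHomology := isNoetherian_of_isNoetherianRing_of_finite R _
  suffices h : LinearMap.range f = LinearMap.ker g by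
    have := isNoetherian_of_range_eq_ker f g h
    infer_instance
  apply le_antisymm
  · rintro _ ⟨z, rfl⟩
    obtain ⟨z, rfl⟩ := Submodule.mkQ_surjective _ z
    exact map_zero (Submodule.mkQ _)
  · intro z hz
    obtain ⟨⟨⟨a, b⟩, hab⟩, rfl⟩ := Submodule.mkQ_surjective _ z
    obtain ⟨c, rfl : δ c = b⟩ := (Submodule.Quotient.mk_eq_zero _).1 hz
    simp only [LinearMap.mem_ker, LinearMap.coneSMul_apply, Prod.mk_eq_zero] at hab
    refine ⟨Submodule.mkQ _ ⟨a + x • c, by simpa using hab.1⟩, (Submodule.Quotient.eq _).2 ?_⟩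
    exact ⟨(0, c), show δ.coneSMul x (0, c) = (a + x • c, (0 : D)) - (a, δ c) by simp⟩

/-- If z is a cycle, (z, 0) bounds in the cone, so z = δa + xb with b a cycle. Thus H(D) = 𝔪 H(D),
and Nakayama applies. -/
theorem LinearMap.exact_of_exact_coneSMul [IsLocalRing R] (hδ : δ ∘ₗ δ = 0)
    (hx : x ∈ IsLocalRing.maximalIdeal R) [Module.Finite R δ.SelfHomology]
    (h : Function.Exact (δ.coneSMul x) (δ.coneSMul x)) : Function.Exact δ δ := by
  rw [← LinearMap.subsingleton_selfHomology_iff hδ, ← Submodule.subsingleton_iff R,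
    ← subsingleton_iff_bot_eq_top, eq_comm]
  refine Submodule.eq_bot_of_le_smul_of_le_jacobson_bot (IsLocalRing.maximalIdeal R) ⊤
    Module.Finite.fg_top ?_ (IsLocalRing.maximalIdeal_le_jacobson _)
  rintro z -
  obtain ⟨⟨z, hz⟩, rfl⟩ := Submodule.mkQ_surjective _ z
  obtain ⟨⟨a, b⟩, hab⟩ := (h (z, 0)).1 (by simpa using hz)
  simp only [LinearMap.coneSMul_apply, Prod.mk.injEq, neg_eq_zero] at hab
  have : Submodule.mkQ ((LinearMap.range δ).submoduleOf (LinearMap.ker δ)) ⟨z, hz⟩ =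
      x • Submodule.mkQ _ ⟨b, hab.2⟩ := by
    rw [← map_smul]
    refine (Submodule.Quotient.eq _).2 ⟨a, ?_⟩
    simp [← hab.1]
  rw [this]
  exact Submodule.smul_mem_smul hx trivial

/-- S collects the generators already acting null-homotopically and l those still to be treated;
each cone moves one from l to S. -/
theorem exact_of_exact_lTensor_residue [IsLocalRing R] [IsNoetherianRing R] (l : List R)
    (S : Set R) (hS : Ideal.span (S ∪ {x | x ∈ l}) = IsLocalRing.maximalIdeal R)
    {D : Type v} [AddCommGroup D] [Module R D] [Module.Flat R D] {δ : D →ₗ[R] D} (hδ : δ ∘ₗ δ = 0)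
    [Module.Finite R δ.SelfHomology]
    (hhom : ∀ x ∈ S, ∃ h : D →ₗ[R] D, δ ∘ₗ h + h ∘ₗ δ = x • LinearMap.id)
    (hk : Function.Exact (δ.lTensor (R ⧸ IsLocalRing.maximalIdeal R))
      (δ.lTensor (R ⧸ IsLocalRing.maximalIdeal R))) : Function.Exact δ δ := by
  induction l generalizing S D with
  | nil =>
    exact exact_of_exact_lTensor_quotient_bot hδ
      (exact_lTensor_quotient_of_homotopy hδ (by simpa using hS) hhom hk ⊥)
  | cons x l ih =>
    have hx : x ∈ IsLocalRing.maximalIdeal R := hS ▸ Ideal.subset_span (by simp)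
    refine LinearMap.exact_of_exact_coneSMul hδ hx ?_
    have := Module.Flat.prod_self (R := R) (D := D)
    have := LinearMap.finite_selfHomology_coneSMul (δ := δ) (x := x)
    refine ih (insert x S) ?_ (LinearMap.coneSMul_comp_self hδ) ?_
      (LinearMap.exact_lTensor_coneSMul hδ _ hk)
    · rw [← hS]
      congr 1
      ext y
      simp [or_left_comm, or_assoc]
    · rintro y (rfl | hy)
      · exact ⟨_, LinearMap.coneSMul_homotopy_self⟩
      · exact LinearMap.exists_coneSMul_homotopy (hhom y hy)

end Cone

/-! ### Null-homotopies from projective flags -/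

section ProjectiveFlag

variable {R : Type u} [CommRing R] {F : Type v} [AddCommGroup F] [Module R F]
  {E : Type w} [AddCommGroup E] [Module R E] {G : ℕ → Submodule R F}

theorem Submodule.exists_linearMap_of_compatible (hG : Monotone G) (hU : ∀ x, ∃ n, x ∈ G n)
    (H : ∀ n, G n →ₗ[R] E)
    (hH : ∀ n, H (n + 1) ∘ₗ Submodule.inclusion (hG n.le_succ) = H n) :
    ∃ h : F →ₗ[R] E, ∀ n, h ∘ₗ (G n).subtype = H n := by
  have hle {n m : ℕ} (hnm : n ≤ m) (x : F) (hx : x ∈ G n) :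
      H m ⟨x, hG hnm hx⟩ = H n ⟨x, hx⟩ := by
    induction m, hnm using Nat.le_induction with
    | base => rfl
    | succ m hnm ih => rw [← ih, ← hH m]; rfl
  have huniq {n m : ℕ} (x : F) (hn : x ∈ G n) (hm : x ∈ G m) : H n ⟨x, hn⟩ = H m ⟨x, hm⟩ := by
    rw [← hle (le_max_left n m) x hn, ← hle (le_max_right n m) x hm]
  choose N hN using hU
  let h : F →ₗ[R] E :=
    { toFun x := H (N x) ⟨x, hN x⟩
      map_add' x y := by
        have hx := hG (le_max_left (N x) (N y)) (hN x)
        have hy := hG (le_max_right (N x) (N y)) (hN y)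
        rw [huniq x _ hx, huniq y _ hy, huniq (x + y) _ (add_mem hx hy), ← map_add]
        rfl
      map_smul' r x := by
        rw [huniq (r • x) _ (Submodule.smul_mem _ r (hN x)), RingHom.id_apply, ← map_smul]
        rfl }
  exact ⟨h, fun n => LinearMap.ext fun x => huniq x _ x.2⟩

/-- A morphism from a differential module with a projective flag to an acyclic one is
null-homotopic. -/
theorem exists_homotopy_of_projective_flag {δ : F →ₗ[R] F} {ε : E →ₗ[R] E} {f : F →ₗ[R] E}
    (hf : ε ∘ₗ f = f ∘ₗ δ) (hδ : δ ∘ₗ δ = 0) (hε : Function.Exact ε ε) (hG : Monotone G)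
    (h0 : G 0 = ⊥) (hU : ∀ x, ∃ n, x ∈ G n)
    (hproj : ∀ n, Module.Projective R (G (n + 1) ⧸ (G n).submoduleOf (G (n + 1))))
    (hGδ : ∀ n, ∀ x ∈ G (n + 1), δ x ∈ G n) :
    ∃ h : F →ₗ[R] E, ε ∘ₗ h + h ∘ₗ δ = f := by
  have hf' (x) : ε (f x) = f (δ x) := LinearMap.congr_fun hf x
  have hδ' (x) : δ (δ x) = 0 := LinearMap.congr_fun hδ x
  have hmem (n) (x) (hx : x ∈ G n) : δ x ∈ G n := by
    cases n with
    | zero =>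
      rw [h0] at hx ⊢
      rw [(Submodule.mem_bot R).1 hx, map_zero]
      exact zero_mem _
    | succ n => exact hG n.le_succ (hGδ n x hx)
  let Q (n : ℕ) := {h : G n →ₗ[R] E // ∀ x : G n, ε (h x) + h ⟨δ x, hmem n x x.2⟩ = f x}
  have step (n : ℕ) (h : Q n) :
      ∃ h' : Q (n + 1), h'.1 ∘ₗ Submodule.inclusion (hG n.le_succ) = h.1 := by
    obtain ⟨h, hh⟩ := h
    have := hproj n
    let d : G (n + 1) →ₗ[R] G n := δ.restrict (hGδ n)
    let q := ((G n).submoduleOf (G (n + 1))).mkQ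
    obtain ⟨σ, hσ⟩ := Module.projective_lifting_property q LinearMap.id
      (Submodule.mkQ_surjective _)
    have hσ' (p) : q (σ p) = p := LinearMap.congr_fun hσ p
    have hqG (x : G (n + 1)) (hx : (x : F) ∈ G n) : q x = 0 :=
      (Submodule.Quotient.mk_eq_zero _).2 hx
    have hr (x : G (n + 1)) : ((x - σ (q x) : G (n + 1)) : F) ∈ G n :=
      (Submodule.Quotient.mk_eq_zero ((G n).submoduleOf (G (n + 1)))).1
        (show q (x - σ (q x)) = 0 by rw [map_sub, hσ', sub_self])
    let r : G (n + 1) →ₗ[R] G n :=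
      ((G (n + 1)).subtype ∘ₗ (LinearMap.id - σ ∘ₗ q)).codRestrict (G n) hr
    have hrx (x : G (n + 1)) : ((r x : G n) : F) = x - (σ (q x) : G (n + 1)) := rfl
    -- On the complement given by σ, the homotopy χ must solve εχ = ψ. This is possible because ψ
    -- takes values in cycles, hence in boundaries, and the quotient is projective.
    let ψ := f ∘ₗ (G (n + 1)).subtype ∘ₗ σ - h ∘ₗ d ∘ₗ σ
    have hψ (p) : ε (ψ p) = 0 := by
      have h1 := hh (d (σ p))
      have h2 : (⟨δ (d (σ p)), hmem n _ (d (σ p)).2⟩ : G n) = 0 := Subtype.ext (hδ' _)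
      rw [h2, map_zero, add_zero] at h1
      change ε (f (σ p : G (n + 1)) - h (d (σ p))) = 0
      rw [map_sub, h1, hf', sub_eq_zero]
      rfl
    obtain ⟨χ, hχ⟩ := Module.projective_lifting_property ε.rangeRestrict
      (ψ.codRestrict (LinearMap.range ε) fun p => (hε _).1 (hψ p))
      ε.surjective_rangeRestrict
    have hχ' (p) : ε (χ p) = f (σ p : G (n + 1)) - h (d (σ p)) :=
      congrArg Subtype.val (LinearMap.congr_fun hχ p)
    have hext (x : G (n + 1)) (hx : (x : F) ∈ G n) :
        h (r x) + χ (q x) = h ⟨x, hx⟩ := by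
      have : r x = ⟨x, hx⟩ := Subtype.ext (by rw [hrx, hqG x hx, map_zero]; simp)
      rw [hqG x hx, map_zero, add_zero, this]
    refine ⟨⟨h ∘ₗ r + χ ∘ₗ q, fun x => ?_⟩, LinearMap.ext fun x => hext _ x.2⟩
    have h1 : (h ∘ₗ r + χ ∘ₗ q) ⟨δ x, hmem (n + 1) x x.2⟩ = h (d x) :=
      hext ⟨δ x, hmem (n + 1) x x.2⟩ (hGδ n x x.2)
    have h2 : h (d x) = h ⟨δ (r x), hmem n _ (r x).2⟩ + h (d (σ (q x))) := by
      rw [← map_add]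
      refine congrArg h (Subtype.ext ?_)
      change δ x = δ (r x) + δ (σ (q x) : G (n + 1))
      rw [← map_add, hrx, sub_add_cancel]
    rw [h1, h2]
    change ε (h (r x) + χ (q x)) + _ = _
    rw [map_add, hχ', add_add_add_comm, hh, sub_add_cancel, hrx, ← map_add, sub_add_cancel]
  choose next hnext using step
  let H (n : ℕ) : Q n := Nat.rec ⟨0, fun x => by
    have : (x : F) = 0 := (Submodule.mem_bot R).1 (h0 ▸ x.2)
    simp [this]⟩ next n
  obtain ⟨h, hh⟩ := Submodule.exists_linearMap_of_compatible hG hU (fun n => (H n).1)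
    fun n => hnext n (H n)
  refine ⟨h, LinearMap.ext fun x => ?_⟩
  obtain ⟨n, hn⟩ := hU x
  have := (H n).2 ⟨x, hn⟩
  simp only [← hh n] at this
  exact this

end ProjectiveFlag

/-! ### Contractions, and flags reindexed by natural numbers -/

namespace DiffModule

variable {R : Type u} [CommRing R]

theorem isAcyclic_iff_exact (D : DiffModule.{u, v} R) : D.IsAcyclic ↔ Function.Exact D.δ D.δ :=
  LinearMap.subsingleton_selfHomology_iff D.δ_comp_δ

theorem IsContractible.of_homotopy (D : DiffModule.{u, v} R) (s : D →ₗ[R] D)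
    (hs : D.δ ∘ₗ s + s ∘ₗ D.δ = LinearMap.id) : D.IsContractible := by
  have hs' (a) : D.δ (s a) = a - s (D.δ a) := eq_sub_of_add_eq (LinearMap.congr_fun hs a)
  have hδ (a) : D.δ (D.δ a) = 0 := LinearMap.congr_fun D.δ_comp_δ a
  -- Take C = Ker δ, with a ↦ (δsa, δa) inverse to (c', c'') ↦ c' + sc''; no condition on s² is
  -- needed.
  refine ⟨LinearMap.ker D.δ, inferInstance, inferInstance, ⟨⟨LinearEquiv.ofLinearMap
    (((D.δ ∘ₗ s).codRestrict (LinearMap.ker D.δ) fun a => hδ _).prod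
      (D.δ.codRestrict (LinearMap.ker D.δ) hδ))
    ((LinearMap.ker D.δ).subtype.coprod (s ∘ₗ (LinearMap.ker D.δ).subtype)) ?_ ?_, ?_⟩⟩⟩
  · refine LinearMap.ext fun ⟨⟨a, ha⟩, ⟨b, hb⟩⟩ => Prod.ext (Subtype.ext ?_) (Subtype.ext ?_)
    · change D.δ (s (a + s b)) = a
      rw [LinearMap.mem_ker] at ha hb
      simp [hs', ha, hb]
    · change D.δ (a + s b) = b
      rw [LinearMap.mem_ker] at ha hb
      simp [hs', ha, hb]
  · refine LinearMap.ext fun a => ?_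
    change D.δ (s a) + s (D.δ a) = a
    rw [hs', sub_add_cancel]
  · refine LinearMap.ext fun a => Prod.ext (Subtype.ext ?_) (Subtype.ext ?_)
    · change D.δ a = D.δ (s (D.δ a))
      rw [hs', hδ, map_zero, sub_zero]
    · exact (hδ a).symm

namespace Flag

variable {F : DiffModule.{u, v} R} (𝓕 : Flag F)

/-- The members `Fⁿ⁻¹` of a flag, for natural numbers `n`. -/
def natFilt (n : ℕ) : Submodule R F := 𝓕.filt (n - 1)

theorem monotone_filt : Monotone 𝓕.filt := monotone_int_of_le_succ 𝓕.le_succ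

theorem monotone_natFilt : Monotone 𝓕.natFilt := fun _ _ h => 𝓕.monotone_filt (by lia)

theorem natFilt_zero : 𝓕.natFilt 0 = ⊥ := 𝓕.filt_neg_one

theorem natFilt_succ (n : ℕ) : 𝓕.natFilt (n + 1) = 𝓕.filt n :=
  congrArg 𝓕.filt (by lia)

theorem exists_mem_natFilt (x : F) : ∃ n, x ∈ 𝓕.natFilt n := by
  obtain ⟨n, hn⟩ := Set.mem_iUnion.1 (𝓕.iUnion_filt.symm ▸ Set.mem_univ x)
  -- The index n may be negative; truncation only enlarges the member of the flag.
  exact ⟨(n + 1).toNat, 𝓕.monotone_filt (by lia) hn⟩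

theorem δ_mem_natFilt (n : ℕ) (x : F) (hx : x ∈ 𝓕.natFilt (n + 1)) : F.δ x ∈ 𝓕.natFilt n :=
  𝓕.map_δ_le n (Submodule.mem_map_of_mem (𝓕.natFilt_succ n ▸ hx))

theorem IsFlat.natFilt {𝓕 : Flag F} (h : 𝓕.IsFlat) (n : ℕ) :
    Module.Flat R
      (𝓕.natFilt (n + 1) ⧸ (𝓕.natFilt n).submoduleOf (𝓕.natFilt (n + 1))) := by
  rw [natFilt_succ]
  exact h n

theorem IsProjective.natFilt {𝓕 : Flag F} (h : 𝓕.IsProjective) (n : ℕ) :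
    Module.Projective R
      (𝓕.natFilt (n + 1) ⧸ (𝓕.natFilt n).submoduleOf (𝓕.natFilt (n + 1))) := by
  rw [natFilt_succ]
  exact h n

end Flag

end DiffModule

theorem mainTheorem6 {R : Type*} [CommRing R] [IsLocalRing R] [IsNoetherianRing R]
    (M : Type*) [AddCommGroup M] [Module R M]
    (hM : IsLocalRing.maximalIdeal R • (⊤ : Submodule R M) ≠ ⊤)
    (D F : DiffModule R) (hDF : D.IsRetract F)
    (hF : ∃ 𝓕 : DiffModule.Flag F, 𝓕.IsFlat)
    (hfin : Module.Finite R D.Homology)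
    (hacyc : (DiffModule.tensor M D).IsAcyclic) :
    D.IsAcyclic ∧
      ((∃ 𝓕 : DiffModule.Flag F, 𝓕.IsProjective) → D.IsContractible) := by
  obtain ⟨ι, π, hπι⟩ := hDF
  obtain ⟨𝓕, hflat⟩ := hF
  have hD : Function.Exact D.δ D.δ := by
    have : Module.Flat R F := Module.Flat.of_flat_succ 𝓕.monotone_natFilt 𝓕.natFilt_zero
      𝓕.exists_mem_natFilt hflat.natFilt
    have : Module.Flat R D := Module.Flat.of_retract ι.toLinearMap π.toLinearMap hπι
    obtain ⟨l, hl⟩ := (isNoetherianRing_iff_ideal_fg R).1 inferInstance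
      (IsLocalRing.maximalIdeal R)
    refine exact_of_exact_lTensor_residue l.toList ∅ (by simpa using hl) D.δ_comp_δ (by simp) ?_
    exact exact_lTensor_quotient_of_exact_lTensor hM hπι ι.comm π.comm F.δ_comp_δ D.δ_comp_δ
      𝓕.monotone_natFilt 𝓕.natFilt_zero 𝓕.exists_mem_natFilt hflat.natFilt 𝓕.δ_mem_natFilt
      ((DiffModule.isAcyclic_iff_exact _).1 hacyc)
  refine ⟨D.isAcyclic_iff_exact.2 hD, ?_⟩
  rintro ⟨𝓟, hproj⟩
  obtain ⟨h, hh⟩ := exists_homotopy_of_projective_flag π.comm F.δ_comp_δ hD 𝓟.monotone_natFilt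
    𝓟.natFilt_zero 𝓟.exists_mem_natFilt hproj.natFilt 𝓟.δ_mem_natFilt
  refine DiffModule.IsContractible.of_homotopy D (h ∘ₗ ι.toLinearMap) ?_
  rw [LinearMap.comp_assoc, ← ι.comm, ← LinearMap.comp_assoc, ← LinearMap.comp_assoc,
    ← LinearMap.add_comp, hh, hπι]
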